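/- Let $\mathcal O$ be the ring of germs at $0\in\mathbb C$ of holomorphic functions of $t$ and let $\epsilon=t\,\frac{d}{dt}$. A Fuchsian operator of order $n\ge 0$ is a differential operator $L=\sum_{i=0}^n a_i(t)\,\epsilon^i$ with $a_i\in\mathcal O$ and $a_n(0)\neq0$. It has a unique convergent expansion $L=\sum_{k\ge0}t^kp_k(\epsilon)$ with $p_k\in\mathbb C[\epsilon]$, $\deg p_k\le n$, $\deg p_0=n$; the polynomial $p_0=\mathcal E(L)$ is its Euler part, and is itself a Fuchsian operator. Two Fuchsian operators $L,M$ of the same order are $\mathcal F$-equivalent if there are Fuchsian operators $H,K$, of any orders, with $MH=KL$ and $\gcd(\mathcal E(H),\mathcal E(L))=1$. The operator $L$ is nonresonant if no two roots of $\mathcal E(L)$ differ by a positive integer (multiple roots are allowed). Let $L=\sum_{k\ge0}t^kp_k(\epsilon)$ be a nonresonant Fuchsian operator of order $n$. Then $L$ is $\mathcal F$-equivalent to its Euler part $\mathcal E(L)=p_0\in\mathbb C[\epsilon]$. Moreover, for every polynomial $h_0\in\mathbb C[\epsilon]$ of degree $n-1$ (where $n\ge1$) that is relatively prime to $p_0$,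 the triangular system of homological equations $$p_0(\epsilon+j)\,h_j(\epsilon)=\sum_{i=0}^{j}k_{j-i}(\epsilon+i)\,p_i(\epsilon),\qquad j=0,1,2,\dots,$$ has exactly one solution $(h_j,k_j)_{j\ge0}$ with the given $h_0$, with $k_0=h_0$ and with $\deg h_j,\deg k_j\le n-1$ for all $j$. The series $H=\sum_{j\ge0}t^jh_j(\epsilon)$ and $K=\sum_{j\ge0}t^jk_j(\epsilon)$ converge, that is, they are Fuchsian operators of order $n-1$ with coefficients in $\mathcal O$, and $\mathcal E(L)\,H=K\,L$. -/

import Mathlib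

open scoped Polynomial PowerSeries

noncomputable section

namespace FuchsOp

/-- A formal power series `f` in `t` is *convergent* if it is the Taylor series at `0` of a function
that is holomorphic near `0`. The ring of germs at `0` of holomorphic functions is the
ring of convergent power series. -/
def IsConvergent (f : ℂ⟦X⟧) : Prop :=
  ∃ g : ℂ → ℂ,
    HasFPowerSeriesAt g (FormalMultilinearSeries.ofScalars ℂ fun n => PowerSeries.coeff n f) 0

/-- Convergence of a power series in terms of the size of its coefficients. -/
theorem isConvergent_iff (f : ℂ⟦X⟧) :
    IsConvergent f ↔ ∃ C r : ℝ, 0 < r ∧ ∀ n, ‖PowerSeries.coeff n f‖ * r ^ n ≤ C := by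
  have key : ∀ n, ‖FormalMultilinearSeries.ofScalars ℂ (fun n => PowerSeries.coeff n f) n‖
      = ‖PowerSeries.coeff n f‖ := fun n => by
    simp
  constructor
  · rintro ⟨g, hg⟩
    obtain ⟨r, hr0, hr⟩ := ENNReal.lt_iff_exists_nnreal_btwn.1 hg.radius_pos
    obtain ⟨C, -, hC⟩ := FormalMultilinearSeries.norm_mul_pow_le_of_lt_radius _ hr
    refine ⟨C, r, by exact_mod_cast hr0, fun n => ?_⟩
    rw [← key]
    exact hC n
  · rintro ⟨C, r, hr, h⟩
    lift r to NNReal using hr.le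
    have hrad : (r : ENNReal) ≤
        (FormalMultilinearSeries.ofScalars ℂ fun n => PowerSeries.coeff n f).radius :=
      FormalMultilinearSeries.le_radius_of_bound _ C fun n => by
        rw [key]
        exact h n
    have hpos : 0 < (FormalMultilinearSeries.ofScalars ℂ fun n => PowerSeries.coeff n f).radius :=
      lt_of_lt_of_le (by exact_mod_cast hr) hrad
    exact ⟨_, FormalMultilinearSeries.hasFPowerSeriesOnBall _ hpos |>.hasFPowerSeriesAt⟩

/-- The Euler derivation `ε = t d/dt`. -/
def eulerD : Module.End ℂ ℂ⟦X⟧ :=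
  LinearMap.mulLeft ℂ (PowerSeries.X : ℂ⟦X⟧) * (PowerSeries.derivative ℂ).toLinearMap

/-- The differential operator `∑ aᵢ εⁱ` with the coefficients `aᵢ` of the polynomial `a`, standing
to the left of the powers of `ε`, as an endomorphism of the space of power series. The product of
operators is composition, that is, the product `*` of endomorphisms. (The commutative product of
the polynomial ring `ℂ⟦X⟧[X]` plays no role.) -/
def op (a : ℂ⟦X⟧[X]) : Module.End ℂ ℂ⟦X⟧ :=
  a.sum fun i r => LinearMap.mulLeft ℂ r * eulerD ^ i

theorem eulerD_X_pow (m : ℕ) :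
    eulerD ((PowerSeries.X : ℂ⟦X⟧) ^ m) = (m : ℂ⟦X⟧) * (PowerSeries.X : ℂ⟦X⟧) ^ m := by
  rcases m with _ | m
  · simp [eulerD]
  · simp only [eulerD, Module.End.mul_apply, Derivation.coeFn_coe, LinearMap.mulLeft_apply,
      Derivation.leibniz_pow, Nat.add_sub_cancel, smul_eq_mul, nsmul_eq_mul]
    rw [show (PowerSeries.derivative ℂ) (PowerSeries.X : ℂ⟦X⟧) = 1 from PowerSeries.derivative_X]
    ring

/-- The commutation rule `ε f = f ε + ε(f)`. -/
theorem eulerD_mul_mulLeft (f : ℂ⟦X⟧) :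
    eulerD * LinearMap.mulLeft ℂ f =
      LinearMap.mulLeft ℂ f * eulerD + LinearMap.mulLeft ℂ (eulerD f) := by
  ext1 g
  simp [eulerD, Derivation.leibniz]
  ring

theorem op_X_pow (a : ℂ⟦X⟧[X]) (m : ℕ) :
    op a ((PowerSeries.X : ℂ⟦X⟧) ^ m) = a.eval (m : ℂ⟦X⟧) * (PowerSeries.X : ℂ⟦X⟧) ^ m := by
  have h : ∀ i : ℕ, (eulerD ^ i) ((PowerSeries.X : ℂ⟦X⟧) ^ m) =
      (m : ℂ⟦X⟧) ^ i * (PowerSeries.X : ℂ⟦X⟧) ^ m := by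
    intro i
    induction i with
    | zero => simp
    | succ i ih =>
      have e : (m : ℂ⟦X⟧) ^ i * (PowerSeries.X : ℂ⟦X⟧) ^ m
          = ((m : ℂ) ^ i) • (PowerSeries.X : ℂ⟦X⟧) ^ m := by
        rw [PowerSeries.smul_eq_C_mul]; simp
      rw [pow_succ', Module.End.mul_apply, ih, e, map_smul, eulerD_X_pow,
        PowerSeries.smul_eq_C_mul]
      simp only [map_pow, map_natCast]
      ring
  rw [op, Polynomial.sum_def, Polynomial.eval_eq_sum, Polynomial.sum_def, LinearMap.sum_apply,
    Finset.sum_mul]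
  refine Finset.sum_congr rfl fun i _ => ?_
  rw [Module.End.mul_apply, h, LinearMap.mulLeft_apply]
  ring

/-- An operator determines its coefficients: its standard form is unique. -/
theorem op_injective : Function.Injective op := by
  intro a b hab
  refine Polynomial.eq_of_infinite_eval_eq a b ?_
  have hinj : Function.Injective fun m : ℕ => (m : ℂ⟦X⟧) := fun m n h => by
    have h' := congrArg (PowerSeries.constantCoeff (R := ℂ)) h
    simpa using h'
  refine (Set.infinite_range_of_injective (f := fun m : ℕ => (m : ℂ⟦X⟧)) hinj).mono ?_
  rintro _ ⟨m, rfl⟩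
  have h := congrArg (fun T => T ((PowerSeries.X : ℂ⟦X⟧) ^ m)) hab
  simp only [op_X_pow] at h
  exact mul_right_cancel₀ (pow_ne_zero _ PowerSeries.X_ne_zero) h

end FuchsOp

/-- A Fuchsian operator `∑_{i ≤ n} aᵢ(t) εⁱ`: all coefficients are holomorphic germs at `0`, and the
leading coefficient does not vanish at `0`. -/
structure FuchsianOperator where
  /-- The coefficients, as a polynomial in `ε`. -/
  coeffs : ℂ⟦X⟧[X]
  convergent : ∀ i, FuchsOp.IsConvergent (coeffs.coeff i)
  leading_ne : PowerSeries.constantCoeff coeffs.leadingCoeff ≠ 0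

namespace FuchsianOperator

/-- The operator as an endomorphism; products of operators are taken here. -/
def toOp (L : FuchsianOperator) : Module.End ℂ ℂ⟦X⟧ := FuchsOp.op L.coeffs

/-- The order of the operator. -/
def order (L : FuchsianOperator) : ℕ := L.coeffs.natDegree

/-- The polynomial `pₖ` of the noncommutative Taylor expansion `L = ∑ tᵏ pₖ(ε)`. -/
def taylorCoeff (L : FuchsianOperator) (k : ℕ) : ℂ[X] :=
  ∑ i ∈ Finset.range (L.order + 1), Polynomial.monomial i (PowerSeries.coeff k (L.coeffs.coeff i))

/-- The Euler part `p₀` of `L = ∑ tᵏ pₖ(ε)`, as a polynomial. -/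
def eulerPart (L : FuchsianOperator) : ℂ[X] := L.taylorCoeff 0

theorem coeff_taylorCoeff (L : FuchsianOperator) (k i : ℕ) :
    (L.taylorCoeff k).coeff i = PowerSeries.coeff k (L.coeffs.coeff i) := by
  simp only [taylorCoeff, Polynomial.finsetSum_coeff, Polynomial.coeff_monomial,
    Finset.sum_ite_eq', Finset.mem_range]
  split_ifs with h
  · rfl
  · rw [Polynomial.coeff_eq_zero_of_natDegree_lt (by unfold order at h; omega), map_zero]

theorem eulerPart_ne_zero (L : FuchsianOperator) : L.eulerPart ≠ 0 := by
  intro h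
  apply L.leading_ne
  have := L.coeff_taylorCoeff 0 L.coeffs.natDegree
  rw [← eulerPart, h] at this
  simpa using this.symm

/-- A nonzero polynomial `p ∈ ℂ[ε]` as an operator with constant coefficients. -/
def ofPolynomial (p : ℂ[X]) (hp : p ≠ 0) : FuchsianOperator where
  coeffs := p.map (PowerSeries.C (R := ℂ))
  convergent i := by
    rw [FuchsOp.isConvergent_iff, Polynomial.coeff_map]
    refine ⟨‖p.coeff i‖, 1, one_pos, fun n => ?_⟩
    rw [PowerSeries.coeff_C]
    split_ifs <;> simp
  leading_ne := by
    rw [Polynomial.leadingCoeff_map_of_injective PowerSeries.C_injective]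
    simpa using hp

/-- The Euler part of a Fuchsian operator, as an operator. -/
def eulerization (L : FuchsianOperator) : FuchsianOperator :=
  ofPolynomial L.eulerPart L.eulerPart_ne_zero

/-- Fuchsian equivalence: the operators `L`, `M` have the same order, and `M H = K L` for some
Fuchsian operators `H`, `K` such that the Euler parts of `H` and `L` are relatively prime. -/
def FEquiv (L M : FuchsianOperator) : Prop :=
  L.order = M.order ∧
    ∃ H K : FuchsianOperator,
      M.toOp * H.toOp = K.toOp * L.toOp ∧ IsCoprime H.eulerPart L.eulerPart

/-- `L` is nonresonant: no two roots of its Euler part differ by a positive integer. -/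
def Nonresonant (L : FuchsianOperator) : Prop :=
  ∀ a b : ℂ, L.eulerPart.IsRoot a → L.eulerPart.IsRoot b → ∀ j : ℕ, 0 < j → a - b ≠ j

/-- The shift `w(ε) ↦ w(ε + j)`. -/
def shift (j : ℕ) (w : ℂ[X]) : ℂ[X] := w.comp (Polynomial.X + Polynomial.C (j : ℂ))

/-- The triangular system of homological equations
`p₀(ε + j) hⱼ = ∑_{i ≤ j} k_{j-i}(ε + i) pᵢ`, `j ≥ 0`, for a pair of sequences of polynomials of
degree less than the order of `L = ∑ tᵏ pₖ(ε)`. -/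
def SolvesHomological (L : FuchsianOperator) (h k : ℕ → ℂ[X]) : Prop :=
  (∀ j, (h j).degree < L.order) ∧ (∀ j, (k j).degree < L.order) ∧
    ∀ j, shift j L.eulerPart * h j =
      ∑ i ∈ Finset.range (j + 1), shift i (k (j - i)) * L.taylorCoeff i

end FuchsianOperator

end

/-! At level j ≥ 1 the homological equation reads p₀(ε + j) hⱼ = kⱼ p₀ + rⱼ, where rⱼ involves only
earlier k's. The Sylvester map (h, k) ↦ p₀(ε + j) h - k p₀, from pairs of degree < n to polynomials
of degree < 2n, is bijective when p₀(ε + j) and p₀ are coprime, and nonresonance says exactly this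
for all j ≥ 1. Hence the formal solution exists and is unique (`exists_sylvester`,
`sylvester_unique`).

Convergence needs inverses bounded uniformly in j. With s = 1/j, the polynomial sⁿ p₀(X + 1/s)
extends continuously to s = 0, where it is the nonzero leading coefficient of p₀ and so still
coprime to p₀. The parameters 0, 1, 1/2, 1/3, … form a compact set, and injectivity on it gives a
uniform lower bound (`exists_uniform_sylvester_bound`). A shift by i costs at most a factor 2^(n i),
so the norms satisfy a convolution inequality with geometric weights and grow geometrically
(`le_geometric_of_le_convolution`). The two series therefore define Fuchsian operators, and the
homological equations are the intertwining relation read off on powers of t. -/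

noncomputable section

/-! ### The ℓ¹ norm on coefficients -/

namespace Polynomial

/-- The sum of the absolute values of the coefficients. -/
def coeffL1 (p : ℂ[X]) : ℝ := p.sum fun _ a => ‖a‖

theorem coeffL1_eq_sum_range {p : ℂ[X]} {n : ℕ} (h : p.natDegree < n) :
    p.coeffL1 = ∑ i ∈ Finset.range n, ‖p.coeff i‖ :=
  p.sum_over_range' (by simp) n h

theorem coeffL1_nonneg (p : ℂ[X]) : 0 ≤ p.coeffL1 :=
  Finset.sum_nonneg fun _ _ => norm_nonneg _

theorem norm_coeff_le_coeffL1 (p : ℂ[X]) (i : ℕ) : ‖p.coeff i‖ ≤ p.coeffL1 := by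
  rw [coeffL1_eq_sum_range (n := p.natDegree + i + 1) (by omega)]
  exact Finset.single_le_sum (f := fun i => ‖p.coeff i‖) (fun _ _ => norm_nonneg _)
    (Finset.mem_range.2 (by omega))

theorem coeffL1_add_le (p q : ℂ[X]) : (p + q).coeffL1 ≤ p.coeffL1 + q.coeffL1 := by
  have h := natDegree_add_le p q
  have hp : p.natDegree < max p.natDegree q.natDegree + 1 := by omega
  have hq : q.natDegree < max p.natDegree q.natDegree + 1 := by omega
  rw [coeffL1_eq_sum_range (Nat.lt_succ_of_le h), coeffL1_eq_sum_range hp,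
    coeffL1_eq_sum_range hq, ← Finset.sum_add_distrib]
  exact Finset.sum_le_sum fun i _ => by simpa using norm_add_le _ _

@[simp] theorem coeffL1_zero : (0 : ℂ[X]).coeffL1 = 0 := by simp [coeffL1]

theorem coeffL1_monomial (n : ℕ) (a : ℂ) : (monomial n a).coeffL1 = ‖a‖ := by
  simp [coeffL1, sum_monomial_index]

@[simp] theorem coeffL1_C (a : ℂ) : (C a).coeffL1 = ‖a‖ := coeffL1_monomial 0 a

theorem coeffL1_sum_le {ι : Type*} (s : Finset ι) (f : ι → ℂ[X]) :
    (∑ i ∈ s, f i).coeffL1 ≤ ∑ i ∈ s, (f i).coeffL1 := by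
  classical
  induction s using Finset.induction_on with
  | empty => simp
  | insert i s hi ih =>
    rw [Finset.sum_insert hi, Finset.sum_insert hi]
    exact (coeffL1_add_le _ _).trans (by gcongr)

theorem coeffL1_monomial_mul (n : ℕ) (a : ℂ) (q : ℂ[X]) :
    (monomial n a * q).coeffL1 ≤ ‖a‖ * q.coeffL1 := by
  conv_lhs => rw [q.as_sum_support, Finset.mul_sum]
  refine (coeffL1_sum_le _ _).trans_eq ?_
  simp only [monomial_mul_monomial, coeffL1_monomial, norm_mul, ← Finset.mul_sum]
  rfl

theorem coeffL1_mul_le (p q : ℂ[X]) : (p * q).coeffL1 ≤ p.coeffL1 * q.coeffL1 := by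
  conv_lhs => rw [p.as_sum_support, Finset.sum_mul]
  refine (coeffL1_sum_le _ _).trans ?_
  refine (Finset.sum_le_sum fun i _ => coeffL1_monomial_mul _ _ _).trans_eq ?_
  rw [← Finset.sum_mul]
  rfl

theorem coeffL1_pow_le (p : ℂ[X]) (n : ℕ) : (p ^ n).coeffL1 ≤ p.coeffL1 ^ n := by
  induction n with
  | zero => simpa using (coeffL1_C 1).le
  | succ n ih =>
    rw [pow_succ, pow_succ]
    exact (coeffL1_mul_le _ _).trans (mul_le_mul_of_nonneg_right ih (coeffL1_nonneg _))

/-! ### The Sylvester equation -/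

/-- The Sylvester equation `P h = k p + r` has a solution of low degree. -/
theorem exists_sylvester {P p r : ℂ[X]} {n : ℕ} (hPp : IsCoprime P p) (hp : p.degree = n)
    (hP : P.degree = n) (hr : r.degree < (n + n : ℕ)) :
    ∃ hk : ℂ[X] × ℂ[X], hk.1.degree < n ∧ hk.2.degree < n ∧ P * hk.1 = hk.2 * p + r := by
  have hp0 : p ≠ 0 := by rintro rfl; simp at hp
  obtain ⟨a, b, hab⟩ := hPp
  -- From `a * P + b * p = 1`, the polynomial `r * a` solves the equation modulo `p`. Reducing it
  -- modulo `p` moves the quotient into `k`.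
  have hmod : (r * a) % p = r * a - p * (r * a / p) := EuclideanDomain.mod_eq_sub_mul_div _ _
  have hdeg : ((r * a) % p).degree < n := hp ▸ degree_mod_lt _ hp0
  have heq : P * ((r * a) % p) = (-(r * b + P * (r * a / p))) * p + r := by
    rw [hmod]; linear_combination r * hab
  refine ⟨(_, _), hdeg, ?_, heq⟩
  dsimp only
  set k := -(r * b + P * (r * a / p))
  -- If `k` had degree at least `n`, then `k * p` would have degree at least `2n`, but it equals `P
  -- * h - r`.
  by_contra! hk
  have h1 : ((n + n : ℕ) : WithBot ℕ) ≤ (k * p).degree := by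
    rw [degree_mul, hp, Nat.cast_add]; gcongr
  have h2 : (k * p).degree < (n + n : ℕ) := by
    rw [← sub_eq_of_eq_add heq]
    refine (degree_sub_le _ _).trans_lt (max_lt ?_ hr)
    rw [degree_mul, hP, Nat.cast_add]
    exact WithBot.add_lt_add_left (WithBot.natCast_ne_bot n) hdeg
  exact absurd h1 (not_le.2 h2)

theorem sylvester_eq_zero {P p h k : ℂ[X]} (hPp : IsCoprime P p) (hh : h.degree < p.degree)
    (heq : P * h = k * p) : h = 0 ∧ k = 0 := by
  have hdvd : p ∣ h := hPp.symm.dvd_of_dvd_mul_left ⟨k, by rw [heq, mul_comm]⟩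
  have h0 : h = 0 := eq_zero_of_dvd_of_degree_lt hdvd hh
  refine ⟨h0, ?_⟩
  have hp0 : p ≠ 0 := by rintro rfl; simp at hh
  simpa [h0, hp0] using heq

theorem sylvester_unique {P p r h k h' k' : ℂ[X]} (hPp : IsCoprime P p)
    (hh : h.degree < p.degree) (hh' : h'.degree < p.degree)
    (heq : P * h = k * p + r) (heq' : P * h' = k' * p + r) : h' = h ∧ k' = k := by
  have := sylvester_eq_zero (h := h' - h) (k := k' - k) hPp
    ((degree_sub_le _ _).trans_lt (max_lt hh' hh)) (by linear_combination heq' - heq)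
  exact ⟨sub_eq_zero.1 this.1, sub_eq_zero.1 this.2⟩

/-! ### Uniform bounds for the Sylvester equation -/

/-- `sⁿ p(X + 1/s)` for a polynomial `p` of degree at most `n`, as a function of `s` that also makes
sense at `s = 0`. -/
def rescaledShift (n : ℕ) (p : ℂ[X]) (s : ℂ) : ℂ[X] :=
  ∑ i ∈ Finset.range (n + 1), C (p.coeff i * s ^ (n - i)) * (C s * X + 1) ^ i

theorem C_pow_mul_rescaledShift {n : ℕ} {p : ℂ[X]} (hp : p.natDegree ≤ n) {c : ℂ} (hc : c ≠ 0) :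
    C (c ^ n) * rescaledShift n p c⁻¹ = p.comp (X + C c) := by
  rw [comp_eq_sum_left, sum_over_range' _ (by simp) (n + 1) (by omega), rescaledShift,
    Finset.mul_sum]
  refine Finset.sum_congr rfl fun i hi => ?_
  have hin : i ≤ n := by simpa [Nat.lt_succ_iff] using hi
  have h1 : X + C c = C c * (C c⁻¹ * X + 1) := by
    rw [mul_add, ← mul_assoc, ← C_mul, mul_inv_cancel₀ hc]; simp
  have h2 : c ^ n * (p.coeff i * c⁻¹ ^ (n - i)) = p.coeff i * c ^ i := by
    rw [← Nat.sub_add_cancel hin, pow_add, Nat.add_sub_cancel, inv_pow]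
    field_simp
  rw [h1, mul_pow, ← mul_assoc, ← C_mul, h2, C_mul, C_pow, mul_assoc]

/-- This is the limit of infinite shift: for `p` of degree `n` it is a nonzero constant, so
coprimality with `p` survives. -/
theorem rescaledShift_zero (n : ℕ) (p : ℂ[X]) : rescaledShift n p 0 = C (p.coeff n) := by
  rw [rescaledShift, Finset.sum_range_succ, Finset.sum_eq_zero]
  · simp
  · intro i hi
    have : n - i ≠ 0 := by have := Finset.mem_range.1 hi; omega
    simp [this]

theorem natDegree_rescaledShift_le (n : ℕ) (p : ℂ[X]) (s : ℂ) :
    (rescaledShift n p s).natDegree ≤ n := by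
  refine natDegree_sum_le_of_forall_le _ _ fun i hi => ?_
  have hin : i ≤ n := by simpa [Nat.lt_succ_iff] using hi
  refine (natDegree_C_mul_le _ _).trans (natDegree_pow_le.trans ?_)
  have : (C s * X + 1 : ℂ[X]).natDegree ≤ 1 := natDegree_linear_le (a := s) (b := 1)
  nlinarith

section Continuity

variable {T : Type*} [TopologicalSpace T]

theorem continuous_coeff_mul {f g : T → ℂ[X]} (hf : ∀ m, Continuous fun s => (f s).coeff m)
    (hg : ∀ m, Continuous fun s => (g s).coeff m) (m : ℕ) :
    Continuous fun s => (f s * g s).coeff m := by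
  simp only [coeff_mul]
  exact continuous_finsetSum _ fun i _ => (hf _).mul (hg _)

theorem continuous_coeff_pow {f : T → ℂ[X]} (hf : ∀ m, Continuous fun s => (f s).coeff m)
    (i m : ℕ) : Continuous fun s => (f s ^ i).coeff m := by
  induction i generalizing m with
  | zero => simpa using continuous_const
  | succ i ih => simpa only [pow_succ] using continuous_coeff_mul ih hf m

theorem continuous_coeff_C {f : T → ℂ} (hf : Continuous f) (m : ℕ) :
    Continuous fun s => (C (f s)).coeff m := by
  rcases m with _ | m
  · simpa using hf
  · simpa [coeff_C] using continuous_const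

theorem continuous_coeff_rescaledShift (n : ℕ) (p : ℂ[X]) (m : ℕ) :
    Continuous fun s => (rescaledShift n p s).coeff m := by
  simp only [rescaledShift, finsetSum_coeff]
  refine continuous_finsetSum _ fun i _ => continuous_coeff_mul
    (continuous_coeff_C (by fun_prop)) (continuous_coeff_pow (fun m => ?_) i) m
  simp only [coeff_add]
  exact (continuous_coeff_mul (continuous_coeff_C continuous_id)
    (fun _ => continuous_const) m).add continuous_const

end Continuity

/-- The polynomial with coefficients `v`. -/
def ofCoeffs {n : ℕ} (v : Fin n → ℂ) : ℂ[X] := ∑ i : Fin n, monomial (i : ℕ) (v i)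

theorem degree_ofCoeffs_lt {n : ℕ} (v : Fin n → ℂ) : (ofCoeffs v).degree < n := by
  refine (degree_sum_le _ _).trans_lt ?_
  exact (Finset.sup_lt_iff (WithBot.bot_lt_coe n)).2
    fun i _ => (degree_monomial_le _ _).trans_lt (WithBot.coe_lt_coe.2 i.2)

theorem coeff_ofCoeffs {n : ℕ} (v : Fin n → ℂ) (i : Fin n) : (ofCoeffs v).coeff i = v i := by
  simp [ofCoeffs, finsetSum_coeff, coeff_monomial, Fin.val_inj]

theorem ofCoeffs_coeff {n : ℕ} {p : ℂ[X]} (h : p.degree < n) :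
    ofCoeffs (fun i : Fin n => p.coeff i) = p := by
  ext m
  by_cases hm : m < n
  · exact coeff_ofCoeffs _ ⟨m, hm⟩
  · have hnm : (n : WithBot ℕ) ≤ m := by exact_mod_cast not_lt.1 hm
    rw [coeff_eq_zero_of_degree_lt ((degree_ofCoeffs_lt _).trans_le hnm),
      coeff_eq_zero_of_degree_lt (h.trans_le hnm)]

theorem continuous_coeff_ofCoeffs {n : ℕ} (m : ℕ) :
    Continuous fun v : Fin n → ℂ => (ofCoeffs v).coeff m := by
  simp only [ofCoeffs, finsetSum_coeff, coeff_monomial]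
  refine continuous_finsetSum _ fun i _ => ?_
  split_ifs <;> fun_prop

theorem coeffL1_ofCoeffs_le {n : ℕ} (v : Fin n → ℂ) : (ofCoeffs v).coeffL1 ≤ n * ‖v‖ := by
  refine (coeffL1_sum_le _ _).trans ?_
  simp only [coeffL1_monomial]
  refine (Finset.sum_le_sum fun i _ => norm_le_pi_norm v i).trans_eq ?_
  simp

theorem ofCoeffs_smul {n : ℕ} (c : ℂ) (v : Fin n → ℂ) : ofCoeffs (c • v) = C c * ofCoeffs v := by
  simp [ofCoeffs, Finset.mul_sum, C_mul_monomial]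

theorem ofCoeffs_eq_zero {n : ℕ} {v : Fin n → ℂ} (h : ofCoeffs v = 0) : v = 0 := by
  ext i
  rw [← coeff_ofCoeffs v, h]; simp

/-- The truncated coefficient norm of `Q h - k p`. -/
def sylvesterNorm (n : ℕ) (p Q h k : ℂ[X]) : ℝ :=
  ∑ m ∈ Finset.range (n + n), ‖(Q * h - k * p).coeff m‖

theorem sylvesterNorm_le (n : ℕ) (p Q h k : ℂ[X]) :
    sylvesterNorm n p Q h k ≤ (Q * h - k * p).coeffL1 := by
  rw [coeffL1_eq_sum_range (n := n + n + (Q * h - k * p).natDegree + 1) (by omega)]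
  exact Finset.sum_le_sum_of_subset_of_nonneg (Finset.range_mono (by omega))
    fun _ _ _ => norm_nonneg _

/-- Coprimality makes the Sylvester norm positive on the compact set `S` × unit sphere, where it
attains a positive minimum; homogeneity in `x` does the rest. -/
theorem exists_sylvesterNorm_bound {n : ℕ} {p : ℂ[X]} (hp : p.degree = n) {S : Set ℂ}
    (hS : IsCompact S) (hcop : ∀ s ∈ S, IsCoprime (rescaledShift n p s) p) :
    ∃ c : ℝ, 0 < c ∧ ∀ s ∈ S, ∀ x : (Fin n → ℂ) × (Fin n → ℂ),
      c * ‖x‖ ≤ sylvesterNorm n p (rescaledShift n p s) (ofCoeffs x.1) (ofCoeffs x.2) := by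
  -- The truncation at `n + n` keeps the number of summands fixed, so continuity can be checked
  -- coefficient by coefficient.
  have hcont : Continuous fun y : ℂ × ((Fin n → ℂ) × (Fin n → ℂ)) =>
      sylvesterNorm n p (rescaledShift n p y.1) (ofCoeffs y.2.1) (ofCoeffs y.2.2) := by
    simp only [sylvesterNorm, coeff_sub]
    refine continuous_finsetSum _ fun m _ => (Continuous.sub ?_ ?_).norm
    · exact continuous_coeff_mul
        (fun m => (continuous_coeff_rescaledShift n p m).comp continuous_fst)
        (fun m => (continuous_coeff_ofCoeffs m).comp (continuous_fst.comp continuous_snd)) m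
    · exact continuous_coeff_mul
        (fun m => (continuous_coeff_ofCoeffs m).comp (continuous_snd.comp continuous_snd))
        (fun _ => continuous_const) m
  have hpos : ∀ y ∈ S ×ˢ Metric.sphere (0 : (Fin n → ℂ) × (Fin n → ℂ)) 1,
      0 < sylvesterNorm n p (rescaledShift n p y.1) (ofCoeffs y.2.1) (ofCoeffs y.2.2) := by
    rintro ⟨s, x⟩ ⟨hs, hx⟩
    refine lt_of_le_of_ne (Finset.sum_nonneg fun _ _ => norm_nonneg _) fun h0 => ?_
    have hz := (Finset.sum_eq_zero_iff_of_nonneg fun _ _ => norm_nonneg _).1 h0.symm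
    have heq : rescaledShift n p s * ofCoeffs x.1 - ofCoeffs x.2 * p = 0 := by
      ext m
      rw [coeff_zero]
      by_cases hm : m < n + n
      · exact norm_eq_zero.1 (hz m (Finset.mem_range.2 hm))
      · have hdeg : (rescaledShift n p s * ofCoeffs x.1 - ofCoeffs x.2 * p).degree
            < (n + n : ℕ) := by
          refine (degree_sub_le _ _).trans_lt (max_lt ?_ ?_)
          · rw [degree_mul, Nat.cast_add]
            refine (add_le_add_left (degree_le_of_natDegree_le
              (natDegree_rescaledShift_le n p s)) _).trans_lt ?_
            exact WithBot.add_lt_add_left (WithBot.natCast_ne_bot n) (degree_ofCoeffs_lt _)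
          · rw [degree_mul, hp, Nat.cast_add]
            exact WithBot.add_lt_add_right (WithBot.natCast_ne_bot n) (degree_ofCoeffs_lt _)
        exact coeff_eq_zero_of_degree_lt (hdeg.trans_le (by exact_mod_cast not_lt.1 hm))
    obtain ⟨h1, h2⟩ := sylvester_eq_zero (hcop s hs) (hp ▸ degree_ofCoeffs_lt _)
      (sub_eq_zero.1 heq)
    have : x = 0 := Prod.ext (ofCoeffs_eq_zero h1) (ofCoeffs_eq_zero h2)
    simp [this] at hx
  obtain ⟨c, hc, hle⟩ := (hS.prod (isCompact_sphere _ _)).exists_forall_le' hcont.continuousOn hpos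
  refine ⟨c, hc, fun s hs x => ?_⟩
  rcases eq_or_ne x 0 with rfl | hx
  · rw [norm_zero, mul_zero]
    exact Finset.sum_nonneg fun _ _ => norm_nonneg _
  · have hx' : ‖x‖ ≠ 0 := norm_ne_zero_iff.2 hx
    have hu := hle (s, ((‖x‖⁻¹ : ℝ) : ℂ) • x) ⟨hs, by simp [norm_smul, hx']⟩
    have hscale : sylvesterNorm n p (rescaledShift n p s)
        (ofCoeffs (((‖x‖⁻¹ : ℝ) : ℂ) • x).1) (ofCoeffs (((‖x‖⁻¹ : ℝ) : ℂ) • x).2)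
        = ‖x‖⁻¹ * sylvesterNorm n p (rescaledShift n p s) (ofCoeffs x.1) (ofCoeffs x.2) := by
      simp only [sylvesterNorm, Prod.smul_fst, Prod.smul_snd, ofCoeffs_smul, Finset.mul_sum]
      refine Finset.sum_congr rfl fun m _ => ?_
      rw [mul_left_comm, mul_assoc, ← mul_sub, coeff_C_mul, norm_mul, Complex.norm_real,
        norm_inv, norm_norm]
    rw [hscale, inv_mul_eq_div, le_div_iff₀ (lt_of_le_of_ne (norm_nonneg _) hx'.symm)] at hu
    exact hu

/-- The solutions of `p(X + j) h - k p = r` are bounded by `r`, uniformly in `j`. -/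
theorem exists_uniform_sylvester_bound {n : ℕ} {p : ℂ[X]} (hp : p.degree = n)
    (hcop : ∀ j : ℕ, 0 < j → IsCoprime (p.comp (X + C (j : ℂ))) p) :
    ∃ B : ℝ, 0 ≤ B ∧ ∀ j : ℕ, 0 < j → ∀ h k r : ℂ[X], h.degree < n → k.degree < n →
      p.comp (X + C (j : ℂ)) * h = k * p + r →
      h.coeffL1 ≤ B * r.coeffL1 ∧ k.coeffL1 ≤ B * r.coeffL1 := by
  have hnat : p.natDegree = n := natDegree_eq_of_degree_eq_some hp
  have hlead : p.coeff n ≠ 0 := by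
    rw [← hnat]
    exact leadingCoeff_ne_zero.2 (by rintro rfl; simp at hp)
  have hS : IsCompact (insert 0 (Set.range fun j : ℕ => (1 : ℂ) / (j + 1))) :=
    (tendsto_one_div_add_atTop_nhds_zero_nat (𝕜 := ℂ)).isCompact_insert_range
  obtain ⟨c, hc, hle⟩ := exists_sylvesterNorm_bound hp hS (by
    rintro _ (rfl | ⟨j, rfl⟩)
    · rw [rescaledShift_zero]
      obtain ⟨u, hu⟩ := (isUnit_C.2 hlead.isUnit).exists_left_inv
      exact ⟨u, 0, by rw [hu]; simp⟩
    · have := hcop (j + 1) (by omega)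
      rw [← C_pow_mul_rescaledShift hnat.le (by exact_mod_cast j.succ_ne_zero)] at this
      simpa using this.of_mul_left_right)
  -- The factor `1 / c` inverts the lower bound; `n` compares the ℓ¹ norm with the sup norm of the
  -- coefficient vector.
  refine ⟨n / c, by positivity, fun j hj h k r hh hk heq => ?_⟩
  have hj0 : (j : ℂ) ≠ 0 := by exact_mod_cast hj.ne'
  have hCh : (C ((j : ℂ) ^ n) * h).degree < n := by rwa [degree_C_mul (pow_ne_zero _ hj0)]
  -- Dividing the shifted `p` by `jⁿ` multiplies the unknown `h` by `jⁿ`. As `jⁿ ≥ 1`, a bound for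
  -- `jⁿ h` also bounds `h`.
  have key := hle (j : ℂ)⁻¹ (Or.inr ⟨j - 1, by simp [Nat.cast_sub (show 1 ≤ j from hj)]⟩)
    (fun i => (C ((j : ℂ) ^ n) * h).coeff i, fun i => k.coeff i)
  rw [ofCoeffs_coeff hCh, ofCoeffs_coeff hk] at key
  replace key := key.trans (sylvesterNorm_le _ _ _ _ _)
  rw [mul_left_comm, ← mul_assoc, C_pow_mul_rescaledShift hnat.le hj0, heq,
    add_sub_cancel_left] at key
  set x : (Fin n → ℂ) × (Fin n → ℂ) :=
    (fun i => (C ((j : ℂ) ^ n) * h).coeff i, fun i => k.coeff i)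
  have hx : n * ‖x‖ ≤ n / c * r.coeffL1 := by
    rw [div_mul_eq_mul_div, mul_div_assoc]
    gcongr
    rwa [le_div_iff₀ hc, mul_comm]
  constructor
  · calc h.coeffL1 ≤ (C ((j : ℂ) ^ n) * h).coeffL1 := by
          rw [coeffL1_eq_sum_range (n := h.natDegree + 1) (by omega),
            coeffL1_eq_sum_range (n := h.natDegree + 1)
              (by have := natDegree_C_mul_le ((j : ℂ) ^ n) h; omega)]
          refine Finset.sum_le_sum fun i _ => ?_
          rw [coeff_C_mul, norm_mul, norm_pow, Complex.norm_natCast]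
          exact le_mul_of_one_le_left (norm_nonneg _)
            (one_le_pow₀ (by exact_mod_cast Nat.one_le_iff_ne_zero.2 hj.ne'))
      _ = (ofCoeffs x.1).coeffL1 := by rw [ofCoeffs_coeff hCh]
      _ ≤ n * ‖x.1‖ := coeffL1_ofCoeffs_le _
      _ ≤ n * ‖x‖ := by gcongr; exact norm_fst_le x
      _ ≤ _ := hx
  · calc k.coeffL1 = (ofCoeffs x.2).coeffL1 := by rw [ofCoeffs_coeff hk]
      _ ≤ n * ‖x.2‖ := coeffL1_ofCoeffs_le _
      _ ≤ n * ‖x‖ := by gcongr; exact norm_snd_le x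
      _ ≤ _ := hx

/-- The crude estimate `1 + j ≤ 2 ^ j` makes the cost geometric in `j`, the form that the Grönwall
inequality absorbs. -/
theorem coeffL1_comp_X_add_natCast_le {n : ℕ} {p : ℂ[X]} (hp : p.natDegree ≤ n) (j : ℕ) :
    (p.comp (X + C (j : ℂ))).coeffL1 ≤ (2 ^ n) ^ j * p.coeffL1 := by
  rw [coeffL1_eq_sum_range (p := p) (n := n + 1) (by omega), Finset.mul_sum,
    comp_eq_sum_left, sum_over_range' _ (by simp) (n + 1) (by omega)]
  refine (coeffL1_sum_le _ _).trans (Finset.sum_le_sum fun i hi => ?_)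
  have hin : i ≤ n := by simpa [Nat.lt_succ_iff] using hi
  refine (coeffL1_mul_le _ _).trans ?_
  rw [coeffL1_C, mul_comm]
  gcongr
  have h1 : (X + C (j : ℂ)).coeffL1 ≤ (2 : ℝ) ^ j := by
    refine (coeffL1_add_le _ _).trans ?_
    rw [coeffL1_C, ← monomial_one_one_eq_X, coeffL1_monomial, norm_one, Complex.norm_natCast]
    have := Nat.lt_two_pow_self (n := j)
    exact_mod_cast (by omega : 1 + j ≤ 2 ^ j)
  calc ((X + C (j : ℂ)) ^ i).coeffL1 ≤ (X + C (j : ℂ)).coeffL1 ^ i := coeffL1_pow_le _ _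
    _ ≤ ((2 : ℝ) ^ j) ^ i := pow_le_pow_left₀ (coeffL1_nonneg _) h1 _
    _ ≤ (2 ^ j) ^ n := pow_le_pow_right₀ (one_le_pow₀ (by norm_num)) hin
    _ = (2 ^ n) ^ j := by rw [← pow_mul, ← pow_mul, mul_comm]

end Polynomial

/-! ### Geometric growth from a convolution inequality -/

/-- A discrete Grönwall inequality with geometric weights. -/
theorem le_geometric_of_le_convolution {a : ℕ → ℝ} {D ρ : ℝ} (hD : 0 ≤ D) (hρ : 0 ≤ ρ)
    (h : ∀ j, a (j + 1) ≤ D * ∑ i ∈ Finset.range (j + 1), ρ ^ (i + 1) * a (j - i)) (j : ℕ)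
    (ha : 0 ≤ a 0) :
    a j ≤ a 0 * ((1 + D) * ρ) ^ j := by
  induction j using Nat.strong_induction_on with
  | _ j ih =>
    rcases j with _ | j
    · simp
    -- The sum equals `(1 + D) ^ m - 1`, which is why the ratio `(1 + D) * ρ` reproduces itself.
    have hgeom : ∀ m : ℕ, D * ∑ i ∈ Finset.range m, (1 + D) ^ i ≤ (1 + D) ^ m := fun m => by
      have := mul_geom_sum (1 + D) m
      rw [add_sub_cancel_left] at this
      linarith
    calc a (j + 1) ≤ D * ∑ i ∈ Finset.range (j + 1), ρ ^ (i + 1) * a (j - i) := h j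
      _ ≤ D * ∑ i ∈ Finset.range (j + 1), a 0 * ρ ^ (j + 1) * (1 + D) ^ (j - i) := by
        refine mul_le_mul_of_nonneg_left (Finset.sum_le_sum fun i hi => ?_) hD
        have hij : i < j + 1 := Finset.mem_range.1 hi
        calc ρ ^ (i + 1) * a (j - i) ≤ ρ ^ (i + 1) * (a 0 * ((1 + D) * ρ) ^ (j - i)) := by
              gcongr; exact ih _ (by omega)
          _ = a 0 * (ρ ^ (i + 1) * ρ ^ (j - i)) * (1 + D) ^ (j - i) := by rw [mul_pow]; ring
          _ = _ := by rw [← pow_add, show i + 1 + (j - i) = j + 1 by omega]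
      _ = a 0 * ρ ^ (j + 1) * (D * ∑ i ∈ Finset.range (j + 1), (1 + D) ^ i) := by
        rw [← Finset.mul_sum, Finset.sum_flip (fun i => (1 + D) ^ i)]; ring
      _ ≤ a 0 * ρ ^ (j + 1) * (1 + D) ^ (j + 1) := by gcongr; exact hgeom _
      _ = _ := by rw [mul_pow]; ring

end

noncomputable section

/-! ### Action on power series and the intertwining relation -/

namespace FuchsOp

theorem coeff_eulerD (f : ℂ⟦X⟧) (m : ℕ) :
    PowerSeries.coeff m (eulerD f) = m * PowerSeries.coeff m f := by
  rcases m with _ | m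
  · simp [eulerD]
  · rw [eulerD, Module.End.mul_apply, LinearMap.mulLeft_apply, PowerSeries.coeff_succ_X_mul]
    simp [PowerSeries.coeff_derivative, mul_comm]

theorem coeff_eulerD_pow (i : ℕ) (f : ℂ⟦X⟧) (m : ℕ) :
    PowerSeries.coeff m ((eulerD ^ i) f) = (m : ℂ) ^ i * PowerSeries.coeff m f := by
  induction i with
  | zero => simp
  | succ i ih => rw [pow_succ', Module.End.mul_apply, coeff_eulerD, ih, pow_succ', mul_assoc]

end FuchsOp

namespace FuchsianOperator

open Polynomial

/-- Since `ε` multiplies `tᵐ` by `m`, the term `tᵏ pₖ(ε)` sends `tᵐ` to `pₖ(m) tᵐ⁺ᵏ`. -/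
theorem coeff_toOp (L : FuchsianOperator) (f : ℂ⟦X⟧) (m : ℕ) :
    PowerSeries.coeff m (L.toOp f) = ∑ x ∈ Finset.HasAntidiagonal.antidiagonal m,
      (L.taylorCoeff x.1).eval (x.2 : ℂ) * PowerSeries.coeff x.2 f := by
  rw [toOp, FuchsOp.op, Polynomial.sum_over_range' _ (by simp) (L.order + 1) (Nat.lt_succ_self _),
    LinearMap.sum_apply, map_sum]
  simp only [Module.End.mul_apply, LinearMap.mulLeft_apply, PowerSeries.coeff_mul,
    FuchsOp.coeff_eulerD_pow]
  rw [Finset.sum_comm]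
  refine Finset.sum_congr rfl fun x _ => ?_
  rw [taylorCoeff, eval_finsetSum, Finset.sum_mul]
  exact Finset.sum_congr rfl fun i _ => by rw [eval_monomial, mul_assoc]

theorem eval_shift (j : ℕ) (w : ℂ[X]) (x : ℂ) : (shift j w).eval x = w.eval (x + j) := by
  simp [shift]

theorem taylorCoeff_eulerization_zero (L : FuchsianOperator) :
    L.eulerization.taylorCoeff 0 = L.eulerPart := by
  ext i
  rw [coeff_taylorCoeff]
  simp [eulerization, ofPolynomial]

theorem taylorCoeff_eulerization_succ (L : FuchsianOperator) (k : ℕ) :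
    L.eulerization.taylorCoeff (k + 1) = 0 := by
  ext i
  rw [coeff_taylorCoeff]
  simp [eulerization, ofPolynomial]

theorem coeff_eulerization_toOp (L : FuchsianOperator) (f : ℂ⟦X⟧) (m : ℕ) :
    PowerSeries.coeff m (L.eulerization.toOp f)
      = L.eulerPart.eval (m : ℂ) * PowerSeries.coeff m f := by
  rw [coeff_toOp, Finset.sum_eq_single (0, m), taylorCoeff_eulerization_zero]
  · rintro ⟨u, v⟩ hx hne
    rcases u with _ | u
    · simp_all
    · simp [taylorCoeff_eulerization_succ]
  · simp

/-- The homological equations say that the corresponding operators intertwine `L` with its Euler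
part. -/
theorem eulerization_mul_eq_mul {L H K : FuchsianOperator}
    (h : ∀ j, shift j L.eulerPart * H.taylorCoeff j =
      ∑ i ∈ Finset.range (j + 1), shift i (K.taylorCoeff (j - i)) * L.taylorCoeff i) :
    L.eulerization.toOp * H.toOp = K.toOp * L.toOp := by
  ext f m
  rw [Module.End.mul_apply, Module.End.mul_apply, coeff_eulerization_toOp, coeff_toOp, coeff_toOp]
  have lhs : L.eulerPart.eval (m : ℂ) * ∑ x ∈ Finset.HasAntidiagonal.antidiagonal m,
        (H.taylorCoeff x.1).eval (x.2 : ℂ) * PowerSeries.coeff x.2 f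
      = ∑ x ∈ Finset.HasAntidiagonal.antidiagonal m, ∑ y ∈ Finset.HasAntidiagonal.antidiagonal x.1,
        (K.taylorCoeff y.1).eval ((y.2 + x.2 : ℕ) : ℂ) * (L.taylorCoeff y.2).eval (x.2 : ℂ) *
          PowerSeries.coeff x.2 f := by
    rw [Finset.mul_sum]
    refine Finset.sum_congr rfl fun x hx => ?_
    have hm := Finset.HasAntidiagonal.mem_antidiagonal.1 hx
    -- At `ε = x.2` the shifted Euler part takes the value `p₀(x.1 + x.2) = p₀(m)`.
    have e := congrArg (eval (x.2 : ℂ)) (h x.1)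
    rw [eval_mul, eval_shift, eval_finsetSum] at e
    rw [← mul_assoc, ← hm, Nat.cast_add, add_comm (x.1 : ℂ), e, ← Finset.sum_mul]
    congr 1
    rw [← Finset.Nat.sum_antidiagonal_swap]
    refine (Finset.sum_congr rfl fun i _ => ?_).trans
      (Finset.Nat.sum_antidiagonal_eq_sum_range_succ (fun u v =>
        (K.taylorCoeff v).eval ((u + x.2 : ℕ) : ℂ) * (L.taylorCoeff u).eval (x.2 : ℂ)) x.1).symm
    rw [eval_mul, eval_shift, Nat.cast_add, add_comm (x.2 : ℂ)]
  rw [lhs, Finset.sum_sigma']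
  simp only [coeff_toOp, Finset.mul_sum]
  rw [Finset.sum_sigma']
  -- Both sides are sums over triples with total `m`, bracketed differently.
  refine Finset.sum_nbij' (fun z => ⟨(z.2.1, z.2.2 + z.1.2), (z.2.2, z.1.2)⟩)
    (fun z => ⟨(z.1.1 + z.2.1, z.2.2), (z.1.1, z.2.1)⟩) ?_ ?_ ?_ ?_ ?_
  · rintro ⟨⟨a, b⟩, ⟨c, d⟩⟩ hz
    simp only [Finset.mem_sigma, Finset.HasAntidiagonal.mem_antidiagonal] at hz
    obtain ⟨rfl, rfl⟩ := hz
    simp [add_assoc]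
  · rintro ⟨⟨a, b⟩, ⟨c, d⟩⟩ hz
    simp only [Finset.mem_sigma, Finset.HasAntidiagonal.mem_antidiagonal] at hz
    obtain ⟨rfl, rfl⟩ := hz
    simp [add_assoc]
  · rintro ⟨⟨a, b⟩, ⟨c, d⟩⟩ hz
    simp only [Finset.mem_sigma, Finset.HasAntidiagonal.mem_antidiagonal] at hz
    obtain ⟨rfl, rfl⟩ := hz
    rfl
  · rintro ⟨⟨a, b⟩, ⟨c, d⟩⟩ hz
    simp only [Finset.mem_sigma, Finset.HasAntidiagonal.mem_antidiagonal] at hz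
    obtain ⟨rfl, rfl⟩ := hz
    rfl
  · rintro ⟨⟨a, b⟩, ⟨c, d⟩⟩ _
    rw [mul_assoc]

/-! ### Degrees and growth of Taylor coefficients -/

theorem natDegree_taylorCoeff_le (L : FuchsianOperator) (k : ℕ) :
    (L.taylorCoeff k).natDegree ≤ L.order := by
  rw [taylorCoeff]
  exact natDegree_sum_le_of_forall_le _ _ fun i hi =>
    (natDegree_monomial_le _).trans (Nat.lt_succ_iff.1 (Finset.mem_range.1 hi))

theorem natDegree_eulerPart (L : FuchsianOperator) : L.eulerPart.natDegree = L.order := by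
  refine le_antisymm (L.natDegree_taylorCoeff_le 0) (le_natDegree_of_ne_zero ?_)
  rw [eulerPart, coeff_taylorCoeff]
  simpa using! L.leading_ne

theorem degree_eulerPart (L : FuchsianOperator) : L.eulerPart.degree = L.order := by
  rw [degree_eq_natDegree L.eulerPart_ne_zero, natDegree_eulerPart]

theorem order_eulerization (L : FuchsianOperator) : L.eulerization.order = L.order := by
  rw [← L.natDegree_eulerPart, order, eulerization, ofPolynomial]
  exact natDegree_map_eq_of_injective (f := PowerSeries.C (R := ℂ)) PowerSeries.C_injective _

/-- The Taylor coefficients of a Fuchsian operator grow at most geometrically. -/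
theorem exists_coeffL1_taylorCoeff_le (L : FuchsianOperator) :
    ∃ A ρ : ℝ, 0 ≤ A ∧ 0 < ρ ∧ ∀ k, (L.taylorCoeff k).coeffL1 ≤ A * ρ ^ k := by
  have hconv := fun i => (FuchsOp.isConvergent_iff _).1 (L.convergent i)
  choose A r hr hA using hconv
  have hA0 : ∀ i, 0 ≤ A i := fun i => le_trans (by positivity) (hA i 0)
  -- One ratio for all coefficients: it dominates every `(r i)⁻¹`.
  have hle : ∀ i ∈ Finset.range (L.order + 1),
      (r i)⁻¹ ≤ 1 + ∑ i ∈ Finset.range (L.order + 1), (r i)⁻¹ := fun i hi => by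
    have := Finset.single_le_sum (f := fun i => (r i)⁻¹) (fun i _ => (inv_pos.2 (hr i)).le) hi
    linarith
  refine ⟨∑ i ∈ Finset.range (L.order + 1), A i,
    1 + ∑ i ∈ Finset.range (L.order + 1), (r i)⁻¹, Finset.sum_nonneg fun i _ => hA0 i,
    add_pos_of_pos_of_nonneg one_pos (Finset.sum_nonneg fun i _ => (inv_pos.2 (hr i)).le),
    fun k => ?_⟩
  rw [taylorCoeff, Finset.sum_mul]
  refine (coeffL1_sum_le _ _).trans (Finset.sum_le_sum fun i hi => ?_)
  rw [coeffL1_monomial]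
  calc _ ≤ A i * (r i)⁻¹ ^ k := by
        rw [inv_pow, ← div_eq_mul_inv, le_div_iff₀ (pow_pos (hr i) k)]; exact hA i k
    _ ≤ _ := mul_le_mul_of_nonneg_left
        (pow_le_pow_left₀ (inv_pos.2 (hr i)).le (hle i hi) k) (hA0 i)

/-- A geometrically bounded sequence of polynomials is the sequence of Taylor coefficients of a
Fuchsian operator. -/
theorem exists_taylorCoeff_eq {m : ℕ} {h : ℕ → ℂ[X]} (hdeg : ∀ j, (h j).natDegree ≤ m)
    (h0 : (h 0).coeff m ≠ 0) {A ρ : ℝ} (hρ : 0 < ρ) (hb : ∀ j, (h j).coeffL1 ≤ A * ρ ^ j) :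
    ∃ H : FuchsianOperator, (∀ j, H.taylorCoeff j = h j) ∧ H.order = m := by
  set a : ℂ⟦X⟧[X] := ∑ i ∈ Finset.range (m + 1),
    monomial i (PowerSeries.mk fun j => (h j).coeff i) with ha
  have hcoeff : ∀ i, a.coeff i = PowerSeries.mk fun j => (h j).coeff i := fun i => by
    simp only [ha, finsetSum_coeff, coeff_monomial, Finset.sum_ite_eq', Finset.mem_range]
    split_ifs with hi
    · rfl
    · ext j
      rw [map_zero, PowerSeries.coeff_mk,
        coeff_eq_zero_of_natDegree_lt ((hdeg j).trans_lt (by omega))]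
  have hdega : a.natDegree = m := by
    refine le_antisymm (natDegree_sum_le_of_forall_le _ _ fun i hi =>
      (natDegree_monomial_le _).trans (Nat.lt_succ_iff.1 (Finset.mem_range.1 hi)))
      (le_natDegree_of_ne_zero fun hz => h0 ?_)
    simpa [hcoeff] using congrArg (PowerSeries.coeff 0) hz
  refine ⟨⟨a, fun i => ?_, ?_⟩, fun j => ?_, hdega⟩
  · rw [FuchsOp.isConvergent_iff]
    refine ⟨A, ρ⁻¹, inv_pos.2 hρ, fun j => ?_⟩
    rw [hcoeff, PowerSeries.coeff_mk, inv_pow, ← div_eq_mul_inv, div_le_iff₀ (pow_pos hρ j)]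
    exact (norm_coeff_le_coeffL1 _ _).trans (hb j)
  · rw [leadingCoeff, hdega, hcoeff]
    simpa [← PowerSeries.coeff_zero_eq_constantCoeff_apply] using h0
  · ext i
    rw [coeff_taylorCoeff]
    simp [hcoeff]

/-! ### Formal solution of the homological equations -/

theorem isCoprime_shift_eulerPart {L : FuchsianOperator} (hL : L.Nonresonant) {j : ℕ}
    (hj : 0 < j) : IsCoprime (shift j L.eulerPart) L.eulerPart := by
  rw [isCoprime_iff_aeval_ne_zero_of_isAlgClosed ℂ ℂ]
  intro a
  by_contra! h
  simp only [coe_aeval_eq_eval, eval_shift] at h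
  exact hL (a + j) a h.1 h.2 j hj (by ring)

/-- The right-hand side of the homological equation at level `j + 1`, without its first term. -/
def homologicalRHS (L : FuchsianOperator) (k : ℕ → ℂ[X]) (j : ℕ) : ℂ[X] :=
  ∑ i ∈ Finset.range (j + 1), shift (i + 1) (k (j - i)) * L.taylorCoeff (i + 1)

theorem sum_shift_mul_taylorCoeff_succ (L : FuchsianOperator) (k : ℕ → ℂ[X]) (j : ℕ) :
    ∑ i ∈ Finset.range (j + 1 + 1), shift i (k (j + 1 - i)) * L.taylorCoeff i
      = k (j + 1) * L.eulerPart + L.homologicalRHS k j := by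
  rw [Finset.sum_range_succ', add_comm, homologicalRHS]
  congr 1
  · simp [shift, eulerPart]
  · exact Finset.sum_congr rfl fun i _ => by rw [Nat.add_sub_add_right]

theorem degree_shift (j : ℕ) (w : ℂ[X]) : (shift j w).degree = w.degree := by
  rcases eq_or_ne w 0 with rfl | hw
  · simp [shift]
  · rw [shift, ← taylor_apply, degree_taylor]

theorem degree_homologicalRHS_lt {L : FuchsianOperator} {k : ℕ → ℂ[X]} {j : ℕ}
    (hk : ∀ i ≤ j, (k i).degree < L.order) :
    (L.homologicalRHS k j).degree < (L.order + L.order : ℕ) := by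
  refine (degree_sum_le _ _).trans_lt ?_
  refine (Finset.sup_lt_iff (WithBot.bot_lt_coe _)).2 fun i _ => ?_
  rw [degree_mul, degree_shift, Nat.cast_add]
  refine (add_le_add_right (degree_le_of_natDegree_le
    (L.natDegree_taylorCoeff_le (i + 1))) _).trans_lt ?_
  exact WithBot.add_lt_add_right (WithBot.natCast_ne_bot _) (hk _ (Nat.sub_le _ _))

/-- A sequence that starts at `x` and whose later members are obtained from the earlier ones by the
choice of `f`. -/
def recursiveSeq {α : Type*} (x : α) (f : ℕ → (ℕ → α) → α) : ℕ → α
  | 0 => x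
  -- The guard makes the recursion terminate; `x` is a filler at indices beyond `j`.
  | j + 1 => f j fun i => if _ : i ≤ j then recursiveSeq x f i else x
  decreasing_by omega

theorem exists_solvesHomological {L : FuchsianOperator} (hL : L.Nonresonant) {h₀ : ℂ[X]}
    (hdeg : h₀.degree < L.order) :
    ∃ h k : ℕ → ℂ[X], h 0 = h₀ ∧ k 0 = h₀ ∧ L.SolvesHomological h k := by
  -- The degree hypothesis sits inside the existential so that `choose` yields a total function;
  -- `hs2` later discharges it by strong induction.
  have hex : ∀ j (k : ℕ → ℂ[X] × ℂ[X]), ∃ hk : ℂ[X] × ℂ[X],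
      (∀ i ≤ j, (k i).2.degree < L.order) → hk.1.degree < L.order ∧ hk.2.degree < L.order ∧
        shift (j + 1) L.eulerPart * hk.1
          = hk.2 * L.eulerPart + L.homologicalRHS (fun i => (k i).2) j := fun j k => by
    by_cases hk : ∀ i ≤ j, (k i).2.degree < L.order
    · obtain ⟨hk', h'⟩ := exists_sylvester (isCoprime_shift_eulerPart hL j.succ_pos)
        L.degree_eulerPart ((degree_shift _ _).trans L.degree_eulerPart)
        (degree_homologicalRHS_lt hk)
      exact ⟨hk', fun _ => h'⟩
    · exact ⟨0, fun h => absurd h hk⟩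
  choose f hf using hex
  set s := recursiveSeq (h₀, h₀) f with hs
  have s0 : s 0 = (h₀, h₀) := by rw [hs, recursiveSeq]
  have ssucc : ∀ j, s (j + 1) = f j fun i => if i ≤ j then s i else (h₀, h₀) := fun j => by
    conv_lhs => rw [hs, recursiveSeq]
    simp [hs]
  have hs2 : ∀ j, (s j).2.degree < L.order := by
    intro j
    induction j using Nat.strong_induction_on with
    | _ j ih =>
      rcases j with _ | j
      · simpa [s0] using hdeg
      · rw [ssucc]
        refine (hf j _ fun i hi => ?_).2.1
        rw [if_pos hi]
        exact ih i (by omega)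
  have hstep : ∀ j, (s (j + 1)).1.degree < L.order ∧ shift (j + 1) L.eulerPart * (s (j + 1)).1
      = (s (j + 1)).2 * L.eulerPart + L.homologicalRHS (fun i => (s i).2) j := fun j => by
    have := hf j (fun i => if i ≤ j then s i else (h₀, h₀)) fun i hi => by
      simpa [hi] using hs2 i
    rw [← ssucc] at this
    refine ⟨this.1, this.2.2.trans ?_⟩
    congr 1
    exact Finset.sum_congr rfl fun i _ => by simp
  refine ⟨fun j => (s j).1, fun j => (s j).2, by simp [s0], by simp [s0], fun j => ?_, hs2,
    fun j => ?_⟩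
  · rcases j with _ | j
    · simpa [s0] using hdeg
    · exact (hstep j).1
  · rcases j with _ | j
    · simp [s0, shift, eulerPart, mul_comm]
    · rw [L.sum_shift_mul_taylorCoeff_succ fun j => (s j).2]
      exact (hstep j).2

theorem SolvesHomological.succ {L : FuchsianOperator} {h k : ℕ → ℂ[X]}
    (hs : L.SolvesHomological h k) (j : ℕ) : shift (j + 1) L.eulerPart * h (j + 1)
      = k (j + 1) * L.eulerPart + L.homologicalRHS k j := by
  rw [hs.2.2, sum_shift_mul_taylorCoeff_succ]

theorem SolvesHomological.unique {L : FuchsianOperator} (hL : L.Nonresonant)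
    {h k h' k' : ℕ → ℂ[X]} (hs : L.SolvesHomological h k) (hs' : L.SolvesHomological h' k')
    (hh : h' 0 = h 0) (hk : k' 0 = k 0) : h' = h ∧ k' = k := by
  have key : ∀ j, h' j = h j ∧ k' j = k j := by
    intro j
    induction j using Nat.strong_induction_on with
    | _ j ih =>
      rcases j with _ | j
      · exact ⟨hh, hk⟩
      have hR : L.homologicalRHS k' j = L.homologicalRHS k j :=
        Finset.sum_congr rfl fun i _ => by rw [(ih (j - i) (by omega)).2]
      refine sylvester_unique (isCoprime_shift_eulerPart hL j.succ_pos) ?_ ?_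
        (hs.succ j) (hR ▸ hs'.succ j)
      · exact L.degree_eulerPart ▸ hs.1 _
      · exact L.degree_eulerPart ▸ hs'.1 _
  exact ⟨funext fun j => (key j).1, funext fun j => (key j).2⟩

/-! ### Convergence of the solution -/

theorem coeffL1_homologicalRHS_le {L : FuchsianOperator} {k : ℕ → ℂ[X]}
    (hk : ∀ j, (k j).degree < L.order) {A ρ : ℝ}
    (hL : ∀ i, (L.taylorCoeff i).coeffL1 ≤ A * ρ ^ i) (j : ℕ) :
    (L.homologicalRHS k j).coeffL1 ≤
      A * ∑ i ∈ Finset.range (j + 1), (2 ^ L.order * ρ) ^ (i + 1) * (k (j - i)).coeffL1 := by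
  rw [homologicalRHS, Finset.mul_sum]
  refine (coeffL1_sum_le _ _).trans (Finset.sum_le_sum fun i _ => ?_)
  have h1 := coeffL1_comp_X_add_natCast_le (natDegree_le_of_degree_le (hk (j - i)).le) (i + 1)
  refine (coeffL1_mul_le _ _).trans ((mul_le_mul h1 (hL (i + 1)) (coeffL1_nonneg _)
    (mul_nonneg (by positivity) (coeffL1_nonneg _))).trans_eq ?_)
  rw [mul_pow]; ring

/-- Solutions of the homological equations grow at most geometrically. -/
theorem SolvesHomological.exists_coeffL1_le {L : FuchsianOperator} (hL : L.Nonresonant)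
    {h k : ℕ → ℂ[X]} (hs : L.SolvesHomological h k) :
    ∃ A ρ : ℝ, 0 < ρ ∧ (∀ j, (h j).coeffL1 ≤ A * ρ ^ j) ∧ ∀ j, (k j).coeffL1 ≤ A * ρ ^ j := by
  obtain ⟨A, ρ, hA, hρ, hb⟩ := L.exists_coeffL1_taylorCoeff_le
  obtain ⟨B, hB, hbound⟩ := exists_uniform_sylvester_bound L.degree_eulerPart
    fun j hj => isCoprime_shift_eulerPart hL hj
  set a : ℕ → ℝ := fun j => max (h j).coeffL1 (k j).coeffL1
  have hrec : ∀ j, a (j + 1) ≤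
      B * A * ∑ i ∈ Finset.range (j + 1), (2 ^ L.order * ρ) ^ (i + 1) * a (j - i) := fun j => by
    have h1 := hbound (j + 1) j.succ_pos _ _ _ (hs.1 _) (hs.2.1 _) (hs.succ j)
    refine (max_le h1.1 h1.2).trans ?_
    rw [mul_assoc]
    gcongr
    refine (coeffL1_homologicalRHS_le hs.2.1 hb j).trans ?_
    gcongr
    exact le_max_right _ _
  have hgeom := fun j => le_geometric_of_le_convolution (mul_nonneg hB hA) (by positivity) hrec j
    ((coeffL1_nonneg _).trans (le_max_left _ _))
  exact ⟨a 0, (1 + B * A) * (2 ^ L.order * ρ), by positivity,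
    fun j => (le_max_left _ _).trans (hgeom j), fun j => (le_max_right _ _).trans (hgeom j)⟩

/-- All `h j`, `k j` have degree at most that of `h 0 = k 0`, so the leading coefficients of `H` and
`K` at `t = 0` are that of `h 0`, which is nonzero. -/
theorem exists_intertwining {L : FuchsianOperator} (hL : L.Nonresonant) {h k : ℕ → ℂ[X]}
    (hs : L.SolvesHomological h k) (hh : (h 0).natDegree + 1 = L.order) (hh0 : h 0 ≠ 0)
    (hk : k 0 = h 0) :
    ∃ H K : FuchsianOperator,
      (∀ j, H.taylorCoeff j = h j) ∧ (∀ j, K.taylorCoeff j = k j) ∧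
      H.order + 1 = L.order ∧ K.order + 1 = L.order ∧
      L.eulerization.toOp * H.toOp = K.toOp * L.toOp := by
  obtain ⟨A, ρ, hρ, hbh, hbk⟩ := hs.exists_coeffL1_le hL
  have hdeg : ∀ {w : ℂ[X]}, w.degree < L.order → w.natDegree ≤ (h 0).natDegree := fun {w} hw => by
    rw [← hh] at hw
    exact natDegree_le_iff_coeff_eq_zero.2 fun N hN =>
      coeff_eq_zero_of_degree_lt (hw.trans_le (Nat.cast_le.2 hN))
  have hlead : (h 0).coeff (h 0).natDegree ≠ 0 := leadingCoeff_ne_zero.2 hh0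
  obtain ⟨H, hH, hHo⟩ := exists_taylorCoeff_eq (fun j => hdeg (hs.1 j)) hlead hρ hbh
  obtain ⟨K, hK, hKo⟩ := exists_taylorCoeff_eq (fun j => hdeg (hs.2.1 j)) (hk ▸ hlead) hρ hbk
  refine ⟨H, K, hH, hK, by rw [hHo, hh], by rw [hKo, hh], eulerization_mul_eq_mul fun j => ?_⟩
  simpa only [hH, hK] using hs.2.2 j

theorem exists_isCoprime_natDegree_eq {p : ℂ[X]} (hp : p ≠ 0) (m : ℕ) :
    ∃ h : ℂ[X], h.natDegree = m ∧ IsCoprime h p := by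
  obtain ⟨c, hc⟩ : ∃ c, p.eval c ≠ 0 := by
    by_contra! h
    exact hp (Polynomial.funext fun x => by simpa using h x)
  refine ⟨(X - C c) ^ m, by simp, IsCoprime.pow_left ?_⟩
  exact (irreducible_X_sub_C c).coprime_iff_not_dvd.2 fun h => hc (dvd_iff_isRoot.1 h)

end FuchsianOperator

end

/-! ### The main theorem -/

theorem proposition1 (L : FuchsianOperator) (hL : L.Nonresonant) :
    L.FEquiv L.eulerization ∧
      ∀ h₀ : ℂ[X], h₀.natDegree + 1 = L.order → IsCoprime h₀ L.eulerPart →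
        ∃ h k : ℕ → ℂ[X],
          (h 0 = h₀ ∧ k 0 = h₀ ∧ L.SolvesHomological h k) ∧
          (∀ h' k' : ℕ → ℂ[X], h' 0 = h₀ → k' 0 = h₀ → L.SolvesHomological h' k' →
            h' = h ∧ k' = k) ∧
          ∃ H K : FuchsianOperator,
            (∀ j, H.taylorCoeff j = h j) ∧ (∀ j, K.taylorCoeff j = k j) ∧
            H.order + 1 = L.order ∧ K.order + 1 = L.order ∧
            L.eulerization.toOp * H.toOp = K.toOp * L.toOp := by
  have main : ∀ h₀ : ℂ[X], h₀.natDegree + 1 = L.order → IsCoprime h₀ L.eulerPart →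
        ∃ h k : ℕ → ℂ[X],
          (h 0 = h₀ ∧ k 0 = h₀ ∧ L.SolvesHomological h k) ∧
          (∀ h' k' : ℕ → ℂ[X], h' 0 = h₀ → k' 0 = h₀ → L.SolvesHomological h' k' →
            h' = h ∧ k' = k) ∧
          ∃ H K : FuchsianOperator,
            (∀ j, H.taylorCoeff j = h j) ∧ (∀ j, K.taylorCoeff j = k j) ∧
            H.order + 1 = L.order ∧ K.order + 1 = L.order ∧
            L.eulerization.toOp * H.toOp = K.toOp * L.toOp := by
    intro h₀ hdeg hcop
    have hlt : h₀.degree < L.order :=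
      Polynomial.degree_le_natDegree.trans_lt (by rw [← hdeg]; exact_mod_cast Nat.lt_succ_self _)
    -- For `h₀ = 0` coprimality would make the Euler part a unit, forcing order `0` against
    -- `natDegree + 1 = order`.
    have hne : h₀ ≠ 0 := by
      rintro rfl
      have h1 := Polynomial.natDegree_eq_zero_of_isUnit (isCoprime_zero_left.1 hcop)
      rw [L.natDegree_eulerPart] at h1
      omega
    obtain ⟨h, k, hh, hk, hs⟩ := FuchsianOperator.exists_solvesHomological hL hlt
    refine ⟨h, k, ⟨hh, hk, hs⟩, fun h' k' hh' hk' hs' =>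
      hs.unique hL hs' (hh'.trans hh.symm) (hk'.trans hk.symm), ?_⟩
    exact FuchsianOperator.exists_intertwining hL hs (by rwa [hh]) (by rwa [hh]) (hk.trans hh.symm)
  refine ⟨⟨L.order_eulerization.symm, ?_⟩, main⟩
  rcases Nat.eq_zero_or_pos L.order with h0 | hpos
  · refine ⟨L, L.eulerization, rfl, ?_⟩
    have hu : IsUnit L.eulerPart := by
      rw [Polynomial.isUnit_iff_degree_eq_zero, L.degree_eulerPart, h0, Nat.cast_zero]
    obtain ⟨u, hu⟩ := hu.exists_left_inv
    exact ⟨u, 0, by rw [hu]; simp⟩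
  · obtain ⟨h₀, hdeg, hcop⟩ :=
      FuchsianOperator.exists_isCoprime_natDegree_eq L.eulerPart_ne_zero (L.order - 1)
    obtain ⟨h, k, ⟨hh, -, -⟩, -, H, K, hH, -, -, -, heq⟩ := main h₀ (by omega) hcop
    exact ⟨H, K, heq, by rwa [FuchsianOperator.eulerPart, hH, hh]⟩
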